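/- Let $N\ge 1$ be a square-free integer. For integers $k,m\ge 1$ with $k$ even, let $$P_{k,m,N}(z)=\sum_{\gamma\in\Gamma_\infty\backslash\Gamma_0(N)} j(\gamma,z)^{-k}\,e^{2\pi i m\,\gamma z}\qquad(\operatorname{Im} z>0)$$ be the Poincaré series of weight $k$ and index $m$ at the cusp $i\infty$ for $\Gamma_0(N)=\{\begin{pmatrix}a&b\\c&d\end{pmatrix}\in SL_2(\mathbb Z): N\mid c\}$, where $\Gamma_\infty=\{\begin{pmatrix}1&b\\0&1\end{pmatrix}: b\in\mathbb Z\}$ and $j(\gamma,z)=cz+d$ for $\gamma=\begin{pmatrix}a&b\\c&d\end{pmatrix}$. Then there is a constant $k_0=k_0(N)$, depending only on $N$, such that for every even $k\ge k_0$ and every integer $m$ with $$1\le m\le \frac{(k-1)^2N^2}{16\pi^2}$$ the following holds. The series $P_{k,m,N}(z)$ converges absolutely for every $z$ in the upper half plane and equals the sum of its Fourier expansion at $i\infty$, $P_{k,m,N}(z)=\sum_{n\ge 0}p(n)e^{2\pi i n z}$. Its first Fourier coefficient $p(1)$ is nonzero, and its order of vanishing at $i\infty$ (the least $n$ with $p(n)\ne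 0$) is $v_\infty(P_{k,m,N})=1$. In particular, $P_{k,m,N}$ does not vanish identically. -/

import Mathlib

open scoped MatrixGroups

noncomputable section

namespace PoincareSeries

/-- The group `Γ_∞` of upper triangular matrices `(1 *; 0 1)` in `SL(2, ℤ)`. -/
def GammaInfty : Subgroup SL(2, ℤ) where
  carrier := {γ | γ 0 0 = 1 ∧ γ 1 0 = 0 ∧ γ 1 1 = 1}
  one_mem' := by simp
  mul_mem' := by
    rintro a b ⟨ha, ha', ha''⟩ ⟨hb, hb', hb''⟩
    simp [Matrix.SpecialLinearGroup.coe_mul, Matrix.mul_apply, Fin.sum_univ_two, *]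
  inv_mem' := by
    rintro a ⟨ha, ha', ha''⟩
    rw [Matrix.SpecialLinearGroup.SL2_inv_expl]
    exact ⟨by simpa using ha'', by simpa using ha', by simpa using ha⟩

/-- The automorphy factor `j(γ, z) = c z + d`. -/
def j (γ : SL(2, ℤ)) (z : UpperHalfPlane) : ℂ := (γ 1 0 : ℂ) * (z : ℂ) + (γ 1 1 : ℂ)

/-- `e(z) = exp(2 π i z)`. -/
def e (z : ℂ) : ℂ := Complex.exp (2 * Real.pi * Complex.I * z)

/-- The term `j(γ, z)^{-k} e(m γ z)` of the Poincaré series. -/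
def summand (k m : ℕ) (z : UpperHalfPlane) (γ : SL(2, ℤ)) : ℂ :=
  j γ z ^ (-(k : ℤ)) * e (m * ((γ • z : UpperHalfPlane) : ℂ))

theorem summand_mul_left (k m : ℕ) (z : UpperHalfPlane) (t γ : SL(2, ℤ)) (ht : t ∈ GammaInfty) :
    summand k m z (t * γ) = summand k m z γ := by
  obtain ⟨h1, h2, h3⟩ := ht
  have hj : j (t * γ) z = j γ z := by
    simp [j, Matrix.SpecialLinearGroup.coe_mul, Matrix.mul_apply, Fin.sum_univ_two, h2, h3]
  have hz : (((t * γ) • z : UpperHalfPlane) : ℂ) = ((γ • z : UpperHalfPlane) : ℂ) + (t 0 1 : ℤ) := by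
    rw [mul_smul, UpperHalfPlane.specialLinearGroup_apply]
    simp [h1, h2, h3]
  have he : e (m * (((γ • z : UpperHalfPlane) : ℂ) + (t 0 1 : ℤ)))
      = e (m * ((γ • z : UpperHalfPlane) : ℂ)) := by
    unfold e
    rw [Complex.exp_eq_exp_iff_exists_int]
    exact ⟨m * t 0 1, by push_cast; ring⟩
  rw [summand, summand, hj, hz, he]

/-- The set `Γ_∞ \ Γ_0(N)` of cosets `Γ_∞ γ` with `γ ∈ Γ_0(N)`. -/
abbrev Cosets (N : ℕ) : Type :=
  Quotient (QuotientGroup.rightRel (GammaInfty.subgroupOf (CongruenceSubgroup.Gamma0 N)))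

/-- The term of the Poincaré series as a function of the coset `Γ_∞ γ`. -/
def cosetTerm (k m N : ℕ) (z : UpperHalfPlane) : Cosets N → ℂ :=
  Quotient.lift (fun γ : CongruenceSubgroup.Gamma0 N => summand k m z (γ : SL(2, ℤ))) (by
    intro a b hab
    have h : b * a⁻¹ ∈ GammaInfty.subgroupOf (CongruenceSubgroup.Gamma0 N) :=
      QuotientGroup.rightRel_apply.mp hab
    have h' : (b : SL(2, ℤ)) * (a : SL(2, ℤ))⁻¹ ∈ GammaInfty := by
      simpa [Subgroup.mem_subgroupOf] using h
    simpa using (summand_mul_left k m z _ (a : SL(2, ℤ)) h').symm)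

/-- The Poincaré series `P_{k,m,N}` of weight `k` and index `m` at `i∞` for `Γ_0(N)`. -/
def poincareSeries (k m N : ℕ) (z : UpperHalfPlane) : ℂ := ∑' γ : Cosets N, cosetTerm k m N z γ

/-- The `n`-th Fourier coefficient at `i∞` of a `1`-periodic function on the upper half plane. -/
def fourierCoeff (f : UpperHalfPlane → ℂ) (n : ℕ) : ℂ := (UpperHalfPlane.qExpansion 1 f).coeff n

/-- The order of vanishing `v_∞(f)` at the cusp `i∞` of a `1`-periodic function on the upper half
plane: the least index of a nonzero Fourier coefficient, and `⊤` if there is none. -/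
def vInfty (f : UpperHalfPlane → ℂ) : ℕ∞ := (UpperHalfPlane.qExpansion 1 f).order

end PoincareSeries

end

/-! Write ν = k − 1. Grouping the bottom rows (c, d) by c and applying the Lipschitz formula gives,
up to a factor 2, p(n) = δ_{mn} + a sum over c > 0 with N ∣ c of c^{-k} (−2πi)^k n^ν B_ν(4π²mn/c²)
K(m, n; c). Here B_ν is the Bessel–Clifford function and K a Kloosterman sum
(`hasSum_coeffFormula`). The factor n^ν gives p(0) = 0, so everything rests on p(1) ≠ 0.

The bound on m says exactly that for n = 1 and c ≥ N the argument of B_ν is at most ν²/4. There B_ν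
does not oscillate: e^{-ν/2}/ν! ≤ B_ν ≤ 1/ν!, because B_ν / B_{ν+1} ≥ (ν+1)/2
(`besselClifford.pos_and_le`). The term c = N is therefore at least a constant times e^{-ν/2} N^{-ν}
|K(m, 1; N)|, while the terms c ≥ 2N together are of order (2N)^{-ν}. Since e^{1/2} < 2, the term c
= N wins for large k.

This needs K(m, 1; N) ≠ 0, which is where square-freeness enters: K factors over the primes p ∣ N,
and each factor is a sum of p − 1 p-th roots of unity, which cannot vanish. As K depends only on m
mod N, the lower bound is uniform in m. For m = 1 the diagonal term 1 is present, and the whole sum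
over c is small because of 1/ν!. -/

section

open scoped Nat
open UpperHalfPlane

/-! ### Bessel–Clifford functions before their first zero -/

/-- The Bessel–Clifford function: `J_ν(x) = (x / 2) ^ ν * besselClifford ν (x ^ 2 / 4)`. -/
noncomputable def besselClifford (ν : ℕ) (y : ℝ) : ℝ := ∑' l : ℕ, (-y) ^ l / (l ! * (ν + l)!)

namespace besselClifford

theorem norm_term_le (ν l : ℕ) (y : ℝ) :
    ‖(-y) ^ l / (l ! * (ν + l)!)‖ ≤ (|y| / (ν + 1)) ^ l / l ! * (1 / ν !) := by
  have h : (ν ! : ℝ) * (ν + 1) ^ l ≤ (ν + l)! := mod_cast Nat.factorial_mul_pow_le_factorial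
  rw [norm_div, norm_pow, norm_neg, Real.norm_eq_abs, Real.norm_of_nonneg (by positivity), div_pow,
    div_div, div_mul_div_comm, mul_one]
  refine div_le_div_of_nonneg_left (by positivity) (by positivity) ?_
  calc ((ν : ℝ) + 1) ^ l * l ! * ν ! = l ! * (ν ! * (ν + 1) ^ l) := by ring
    _ ≤ _ := by gcongr

theorem summable (ν : ℕ) (y : ℝ) : Summable fun l : ℕ ↦ (-y) ^ l / ((l ! : ℝ) * (ν + l)!) :=
  Summable.of_norm_bounded ((Real.summable_pow_div_factorial _).mul_right _)
    (norm_term_le ν · y)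

theorem apply_zero (ν : ℕ) : besselClifford ν 0 = 1 / ν ! := by
  rw [besselClifford, tsum_eq_single 0 (fun l hl ↦ by simp [hl])]
  simp

/-- Write 1/(ν+l)! = ((ν+1) + l)/(ν+1+l)!; the part with l becomes, after an index shift, the series
of index ν + 2. -/
theorem recurrence (ν : ℕ) (y : ℝ) :
    besselClifford ν y = (ν + 1) * besselClifford (ν + 1) y - y * besselClifford (ν + 2) y := by
  have h1 : Summable fun l : ℕ ↦ l * ((-y) ^ l / ((l ! : ℝ) * (ν + 1 + l)!)) := by
    rw [← summable_nat_add_iff 1]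
    refine ((summable (ν + 2) y).mul_left (-y)).congr fun l ↦ ?_
    rw [show ν + 1 + (l + 1) = ν + 2 + l by ring, Nat.factorial_succ]
    push_cast
    field_simp
    ring
  have h2 : ∑' l : ℕ, l * ((-y) ^ l / ((l ! : ℝ) * (ν + 1 + l)!))
      = -y * besselClifford (ν + 2) y := by
    rw [h1.tsum_eq_zero_add, besselClifford, ← tsum_mul_left]
    simp only [Nat.cast_zero, zero_mul, zero_add]
    refine tsum_congr fun l ↦ ?_
    rw [show ν + 1 + (l + 1) = ν + 2 + l by ring, Nat.factorial_succ]
    push_cast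
    field_simp
    ring
  rw [sub_eq_add_neg, ← neg_mul, ← h2, besselClifford, besselClifford, ← tsum_mul_left,
    ← ((summable (ν + 1) y).mul_left _).tsum_add h1]
  refine tsum_congr fun l ↦ ?_
  rw [show ν + 1 + l = (ν + l) + 1 by ring, Nat.factorial_succ (ν + l)]
  push_cast
  field_simp
  ring

theorem hasDerivAt (ν : ℕ) (y : ℝ) :
    HasDerivAt (besselClifford ν) (-besselClifford (ν + 1) y) y := by
  have key := hasDerivAt_tsum_of_isPreconnected (𝕜 := ℝ)
    (g := fun (l : ℕ) (x : ℝ) ↦ (-x) ^ l / ((l ! : ℝ) * (ν + l)!))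
    (g' := fun (l : ℕ) (x : ℝ) ↦ (l : ℝ) * (-x) ^ (l - 1) * (-1) / ((l ! : ℝ) * (ν + l)!))
    (u := fun l : ℕ ↦ l * (|y| + 1) ^ (l - 1) / l !) (t := Metric.ball 0 (|y| + 1)) (y₀ := y)
    (y := y) ?_ Metric.isOpen_ball (convex_ball _ _).isPreconnected ?_ ?_ (by simp)
    (summable ν y) (by simp)
  · convert! key using 1
    have hs : Summable fun l : ℕ ↦ (l : ℝ) * (-y) ^ (l - 1) * (-1) / ((l ! : ℝ) * (ν + l)!) := by
      rw [← summable_nat_add_iff 1]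
      refine (summable (ν + 1) y).neg.congr fun l ↦ ?_
      rw [show ν + (l + 1) = ν + 1 + l by ring, Nat.factorial_succ l]
      push_cast
      field_simp
    rw [hs.tsum_eq_zero_add, besselClifford, ← tsum_neg]
    simp only [Nat.cast_zero, zero_mul, zero_add, zero_div]
    refine tsum_congr fun l ↦ ?_
    rw [show ν + (l + 1) = ν + 1 + l by ring, Nat.factorial_succ l]
    push_cast
    field_simp
  · rw [← summable_nat_add_iff 1]
    refine (Real.summable_pow_div_factorial (|y| + 1)).congr fun l ↦ ?_
    rw [Nat.factorial_succ l]
    push_cast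
    field_simp
  · intro l x _
    exact ((hasDerivAt_neg x).pow l).div_const _
  · intro l x hx
    rw [mem_ball_zero_iff] at hx
    rw [norm_div, norm_mul, norm_mul, norm_neg, norm_one, mul_one, norm_pow, norm_neg,
      Real.norm_natCast, Real.norm_of_nonneg (by positivity : (0 : ℝ) ≤ l ! * (ν + l)!)]
    gcongr
    have : (1 : ℝ) ≤ (ν + l)! := mod_cast Nat.one_le_iff_ne_zero.mpr (Nat.factorial_ne_zero _)
    nlinarith [(Nat.cast_pos (α := ℝ)).mpr (Nat.factorial_pos l)]

theorem abs_sub_le (ν : ℕ) (y : ℝ) :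
    |besselClifford ν y - 1 / ν !| ≤ (Real.exp (|y| / (ν + 1)) - 1) * (1 / ν !) := by
  have hs := summable ν y
  have h0 : besselClifford ν y - 1 / ν ! =
      ∑' l : ℕ, (-y) ^ (l + 1) / (((l + 1)! : ℝ) * (ν + (l + 1))!) := by
    rw [besselClifford, hs.tsum_eq_zero_add]
    simp
  have hb := ((Real.summable_pow_div_factorial (|y| / (ν + 1))).mul_right (1 / (ν ! : ℝ)))
  rw [h0, ← Real.norm_eq_abs]
  refine (tsum_of_norm_bounded ((summable_nat_add_iff 1).mpr hb).hasSum
    (fun l ↦ norm_term_le ν (l + 1) y)).trans ?_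
  rw [tsum_mul_right, Real.exp_eq_exp_ℝ, NormedSpace.exp_eq_tsum_div]
  beta_reduce
  rw [(Real.summable_pow_div_factorial (|y| / (ν + 1))).tsum_eq_zero_add]
  simp

/-- For `0 ≤ y ≤ (ν + 1) ^ 2 / 4` the quotient of consecutive functions is at least
`(ν + 1) / 2`. -/
theorem pos_and_le {ν : ℕ} {y : ℝ} (hy : 0 ≤ y) (hν : y ≤ (ν + 1) ^ 2 / 4) :
    0 < besselClifford (ν + 1) y ∧
      (ν + 1) / 2 * besselClifford (ν + 1) y ≤ besselClifford ν y := by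
  -- Downward induction on the index, started at ν ≥ 4y, where the leading term 1/ν! dominates.
  obtain ⟨M, hM⟩ := exists_nat_ge (4 * y)
  obtain ⟨d, hd⟩ : ∃ d, M ≤ ν + d := ⟨M, by omega⟩
  induction d generalizing ν with
  | zero =>
    have hνM : 4 * y ≤ ν := hM.trans (mod_cast hd)
    -- The tolerance 1/3 is what the claim needs: half of the upper factor 4/3 is the lower factor
    -- 2/3.
    have hsmall (μ : ℕ) (hμ : ν ≤ μ) : |besselClifford μ y - 1 / μ !| ≤ 1 / 3 * (1 / μ !) := by
      refine (abs_sub_le μ y).trans (mul_le_mul_of_nonneg_right ?_ (by positivity))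
      have h1 : |y| / (μ + 1) ≤ 1 / 4 := by
        have : (ν : ℝ) ≤ μ := mod_cast hμ
        rw [abs_of_nonneg hy, div_le_iff₀ (by positivity)]
        linarith
      have h2 : Real.exp (|y| / (μ + 1)) ≤ Real.exp (1 / 4) := Real.exp_le_exp.mpr h1
      have h3 : Real.exp (1 / 4) ≤ 4 / 3 := by
        have := Real.add_one_le_exp (-(1 / 4 : ℝ))
        rw [Real.exp_neg] at this
        have h4 := Real.exp_pos (1 / 4)
        rw [le_inv_comm₀ (by norm_num) h4] at this
        exact this.trans (by norm_num)
      linarith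
    have ha := abs_le.mp (hsmall ν le_rfl)
    have hb := abs_le.mp (hsmall (ν + 1) (by omega))
    have hf : (ν + 1) * (1 / ((ν + 1)! : ℝ)) = 1 / ν ! := by
      rw [Nat.factorial_succ]
      push_cast
      field_simp
    have hpos : (0 : ℝ) < 1 / (ν + 1)! := by positivity
    refine ⟨by linarith, ?_⟩
    have : (ν + 1) / 2 * besselClifford (ν + 1) y ≤ (ν + 1) / 2 * (4 / 3 * (1 / (ν + 1)!)) := by
      gcongr
      linarith
    linarith
  | succ d ih =>
    have h1 : y ≤ ((ν + 1 : ℕ) + 1) ^ 2 / 4 := by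
      push_cast
      refine hν.trans ?_
      gcongr
      linarith
    obtain ⟨hp, hle⟩ := ih h1 (by omega)
    have hp1 : 0 < besselClifford (ν + 1) y :=
      lt_of_lt_of_le (mul_pos (by positivity) hp) hle
    refine ⟨hp1, ?_⟩
    rw [recurrence ν y]
    -- With r_ν = B_ν/B_{ν+1} the recurrence reads r_ν = (ν+1) − y/r_{ν+1}, and r_{ν+1} ≥ (ν+2)/2
    -- forces y/r_{ν+1} ≤ (ν+1)/2.
    have h3 : y * besselClifford (ν + 2) y ≤ (ν + 1) / 2 * besselClifford (ν + 1) y := by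
      calc y * besselClifford (ν + 2) y ≤ (ν + 1) ^ 2 / 4 * besselClifford (ν + 2) y := by
            gcongr
        _ ≤ (ν + 1) / 2 * (((ν + 1 : ℕ) + 1) / 2 * besselClifford (ν + 2) y) := by
            rw [← mul_assoc]
            refine mul_le_mul_of_nonneg_right ?_ hp.le
            push_cast
            nlinarith [(Nat.cast_nonneg ν : (0 : ℝ) ≤ ν)]
        _ ≤ _ := by gcongr
    linarith

theorem nonneg {ν : ℕ} {y : ℝ} (hy : 0 ≤ y) (hν : y ≤ (ν + 1) ^ 2 / 4) :
    0 ≤ besselClifford ν y :=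
  have h := pos_and_le hy hν
  le_trans (mul_nonneg (by positivity) h.1.le) h.2

theorem continuous (ν : ℕ) : Continuous (besselClifford ν) :=
  continuous_iff_continuousAt.mpr fun y ↦ (hasDerivAt ν y).continuousAt

theorem le_one_div {ν : ℕ} {y : ℝ} (hy : 0 ≤ y) (hν : y ≤ (ν + 1) ^ 2 / 4) :
    besselClifford ν y ≤ 1 / ν ! := by
  have h : AntitoneOn (besselClifford ν) (Set.Icc 0 y) := by
    refine antitoneOn_of_deriv_nonpos (convex_Icc _ _) (continuous ν).continuousOn
      (fun x _ ↦ (hasDerivAt ν x).differentiableAt.differentiableWithinAt) fun x hx ↦ ?_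
    rw [interior_Icc] at hx
    rw [(hasDerivAt ν x).deriv]
    linarith [(pos_and_le hx.1.le (hx.2.le.trans hν)).1]
  simpa [apply_zero] using h (Set.left_mem_Icc.mpr hy) (Set.right_mem_Icc.mpr hy) hy

/-- The logarithmic derivative −B_{ν+1}/B_ν is at least −2/(ν+1), so exp(2y/(ν+1)) B_ν(y) increases
from its value 1/ν! at 0. -/
theorem exp_mul_one_div_le {ν : ℕ} {y : ℝ} (hy : 0 ≤ y) (hν : y ≤ (ν + 1) ^ 2 / 4) :
    Real.exp (-(2 / (ν + 1) * y)) * (1 / ν !) ≤ besselClifford ν y := by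
  have hd (x : ℝ) := ((hasDerivAt_id x).const_mul (2 / (ν + 1 : ℝ))).exp.mul (hasDerivAt ν x)
  have h : MonotoneOn ((fun x ↦ Real.exp (2 / (ν + 1 : ℝ) * id x)) * besselClifford ν)
      (Set.Icc 0 y) := by
    refine monotoneOn_of_deriv_nonneg (convex_Icc _ _)
      (fun x _ ↦ (hd x).continuousAt.continuousWithinAt)
      (fun x _ ↦ (hd x).differentiableAt.differentiableWithinAt) fun x hx ↦ ?_
    rw [interior_Icc] at hx
    rw [(hd x).deriv]
    have h2 := (pos_and_le hx.1.le (hx.2.le.trans hν)).2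
    have h3 : besselClifford (ν + 1) x ≤ 2 / (ν + 1) * besselClifford ν x := by
      rw [div_mul_eq_mul_div, le_div_iff₀ (by positivity)]
      linarith
    have h4 := Real.exp_pos (2 / (ν + 1 : ℝ) * id x)
    nlinarith
  have h5 := h (Set.left_mem_Icc.mpr hy) (Set.right_mem_Icc.mpr hy) hy
  simp only [Pi.mul_apply, id_eq, mul_zero, Real.exp_zero, one_mul, apply_zero] at h5
  rw [Real.exp_neg, inv_mul_le_iff₀ (Real.exp_pos _)]
  exact h5

end besselClifford

/-! ### Non-vanishing of Kloosterman sums -/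

/-- A vanishing sum of `p`-th roots of unity has a number of terms divisible by `p`. -/
theorem Complex.prime_dvd_card_of_sum_eq_zero {ι : Type*} (s : Finset ι) {p : ℕ} (hp : p.Prime)
    (f : ι → ℂ) (hf : ∀ i, f i ^ p = 1) (h0 : ∑ i ∈ s, f i = 0) : p ∣ s.card := by
  have : NeZero p := ⟨hp.ne_zero⟩
  have : Fact p.Prime := ⟨hp⟩
  have hζ := Complex.isPrimitiveRoot_exp p hp.ne_zero
  set ζ := Complex.exp (2 * Real.pi * Complex.I / p)
  choose g _ hg using fun i ↦ hζ.eq_pow_of_pow_eq_one (hf i)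
  -- A relation among powers of ζ is a multiple of Φ_p in ℤ[X]; evaluating at 1, where Φ_p(1) = p,
  -- counts the terms.
  have hdvd : Polynomial.cyclotomic p ℤ ∣ ∑ i ∈ s, (Polynomial.X : Polynomial ℤ) ^ g i := by
    rw [Polynomial.cyclotomic_eq_minpoly hζ hp.pos]
    refine minpoly.isIntegrallyClosed_dvd (hζ.isIntegral hp.pos) ?_
    simpa [map_sum, hg] using h0
  have := Polynomial.eval_dvd (x := 1) hdvd
  rw [Polynomial.eval_one_cyclotomic_prime, Polynomial.eval_finsetSum] at this
  simpa using Int.natCast_dvd_natCast.mp (by simpa using this)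

/-- The Kloosterman sum `∑ ψ(a u⁻¹ + b u)` over the units of a finite commutative ring. -/
noncomputable def kloostermanSum {R : Type*} [CommRing R] [Fintype Rˣ] (ψ : AddChar R ℂ)
    (a b : R) : ℂ := ∑ u : Rˣ, ψ (a * (u⁻¹ : Rˣ) + b * u)

theorem norm_kloostermanSum_le {R : Type*} [CommRing R] [Finite R] [Fintype Rˣ]
    (ψ : AddChar R ℂ) (a b : R) : ‖kloostermanSum ψ a b‖ ≤ Fintype.card Rˣ := by
  refine (norm_sum_le _ _).trans ?_
  simp [AddChar.norm_apply]

theorem kloostermanSum_ringEquiv {R S : Type*} [CommRing R] [CommRing S] [Fintype Rˣ] [Fintype Sˣ]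
    (σ : R ≃+* S) (ψ : AddChar R ℂ) (a b : R) : kloostermanSum ψ a b =
      kloostermanSum (ψ.compAddMonoidHom (σ.symm : S →+ R)) (σ a) (σ b) :=
  Fintype.sum_equiv (Units.mapEquiv (σ : R ≃* S)).toEquiv _ _ fun u ↦ by
    simp [← map_inv]

/-- Allowing an arbitrary additive character absorbs the twists that the Chinese remainder theorem
introduces for the standard one. -/
theorem kloostermanSum_prod {R S : Type*} [CommRing R] [CommRing S] [Fintype Rˣ] [Fintype Sˣ]
    [Fintype (R × S)ˣ] (ψ : AddChar (R × S) ℂ) (a b : R × S) : kloostermanSum ψ a b =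
      kloostermanSum (ψ.compAddMonoidHom (AddMonoidHom.inl R S)) a.1 b.1 *
        kloostermanSum (ψ.compAddMonoidHom (AddMonoidHom.inr R S)) a.2 b.2 := by
  rw [kloostermanSum, kloostermanSum, kloostermanSum, Finset.sum_mul_sum, ← Finset.sum_product',
    Finset.univ_product_univ]
  refine Fintype.sum_equiv MulEquiv.prodUnits.toEquiv _ _ fun u ↦ ?_
  rw [AddChar.compAddMonoidHom_apply, AddChar.compAddMonoidHom_apply, ← AddChar.map_add_eq_mul]
  congr 1
  ext <;> simp [MulEquiv.prodUnits]

/-- The sum has p − 1 terms, all p-th roots of unity, and p does not divide p − 1. The trivial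
character is included. -/
theorem kloostermanSum_ne_zero_of_prime {p : ℕ} (hp : p.Prime) [Fintype (ZMod p)ˣ]
    (ψ : AddChar (ZMod p) ℂ) (a b : ZMod p) : kloostermanSum ψ a b ≠ 0 := by
  have : Fact p.Prime := ⟨hp⟩
  intro h
  have hdvd := Complex.prime_dvd_card_of_sum_eq_zero Finset.univ hp _ (fun u ↦ ?_) h
  · rw [Finset.card_univ, ZMod.card_units_eq_totient, Nat.totient_prime hp] at hdvd
    have := Nat.le_of_dvd (by have := hp.two_le; omega) hdvd
    have := hp.two_le
    omega
  · rw [← AddChar.map_nsmul_eq_pow, nsmul_eq_mul, CharP.cast_eq_zero, zero_mul,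
      AddChar.map_zero_eq_one]

theorem kloostermanSum_ne_zero {N : ℕ} (hN : Squarefree N) [inst : Fintype (ZMod N)ˣ]
    (ψ : AddChar (ZMod N) ℂ) (a b : ZMod N) : kloostermanSum ψ a b ≠ 0 := by
  revert inst ψ a b
  induction N using Nat.recOnPrimeCoprime with
  | zero => exact absurd hN not_squarefree_zero
  | prime_pow p n hp =>
    intro inst ψ a b
    rcases eq_or_ne n 0 with rfl | hn
    · have : Subsingleton (ZMod (p ^ 0)) := by rw [pow_zero]; infer_instance
      rw [kloostermanSum, Fintype.sum_unique]
      rw [← norm_pos_iff, AddChar.norm_apply]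
      exact one_pos
    · obtain rfl := ((Nat.squarefree_pow_iff hp.ne_one hn).mp hN).2
      -- The modulus is `p ^ 1`, equal to `p` only propositionally; a variable `q` lets the equation
      -- be substituted in the types.
      have key : ∀ q, q = p → ∀ [Fintype (ZMod q)ˣ] (ψ : AddChar (ZMod q) ℂ) (a b : ZMod q),
          kloostermanSum ψ a b ≠ 0 := by
        rintro q rfl _ ψ a b
        exact kloostermanSum_ne_zero_of_prime hp ψ a b
      exact key _ (pow_one p) ψ a b
  | coprime m n hm hn hmn ihm ihn =>
    intro inst ψ a b
    have hsq := (Nat.squarefree_mul hmn).mp hN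
    have : NeZero m := ⟨by omega⟩
    have : NeZero n := ⟨by omega⟩
    classical
    rw [kloostermanSum_ringEquiv (ZMod.chineseRemainder hmn), kloostermanSum_prod]
    exact mul_ne_zero (ihm hsq.1 _ _ _) (ihn hsq.2 _ _ _)

/-- The Kloosterman sums to a square-free modulus are bounded away from zero. -/
theorem exists_le_norm_kloostermanSum {N : ℕ} (hN : Squarefree N) [Fintype (ZMod N)ˣ]
    (ψ : AddChar (ZMod N) ℂ) (b : ZMod N) : ∃ δ > 0, ∀ a, δ ≤ ‖kloostermanSum ψ a b‖ := by
  have : NeZero N := ⟨hN.ne_zero⟩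
  obtain ⟨a₀, h⟩ := Finite.exists_min fun a ↦ ‖kloostermanSum ψ a b‖
  exact ⟨_, norm_pos_iff.mpr (kloostermanSum_ne_zero hN ψ a₀ b), h⟩

/-! ### Majorants for the double series -/

namespace besselClifford

/-- At −Y every term of the series is nonnegative, so this value majorizes the series termwise. -/
theorem abs_le_of_abs_le (ν : ℕ) {y Y : ℝ} (h : |y| ≤ Y) :
    |besselClifford ν y| ≤ besselClifford ν (-Y) := by
  rw [← Real.norm_eq_abs]
  refine tsum_of_norm_bounded (summable ν (-Y)).hasSum fun l ↦ ?_
  rw [norm_div, norm_pow, norm_neg, neg_neg, Real.norm_eq_abs,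
    Real.norm_of_nonneg (by positivity)]
  gcongr

theorem norm_le_of_abs_le (ν : ℕ) {y Y : ℝ} (h : |y| ≤ Y) :
    ‖(besselClifford ν y : ℂ)‖ ≤ besselClifford ν (-Y) := by
  rw [Complex.norm_real]
  exact abs_le_of_abs_le ν h

/-- Half of the decay e^{-δn} pays for (δn/2)^l / l! ≤ e^{δn/2}; what remains is a product of a
convergent series in n and an exponential series in l. -/
theorem summable_pow_mul_exp (ν : ℕ) {A δ : ℝ} (hA : 0 ≤ A) (hδ : 0 < δ) :
    Summable fun p : ℕ × ℕ ↦
      (p.1 : ℝ) ^ ν * Real.exp (-δ * p.1) * ((A * p.1) ^ p.2 / (p.2 ! * (ν + p.2)!)) := by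
  have h1 := (Real.summable_pow_mul_exp_neg_nat_mul ν (half_pos hδ)).mul_of_nonneg
    (Real.summable_pow_div_factorial (A / (δ / 2)))
    (fun n ↦ by positivity) (fun n ↦ by positivity)
  refine h1.of_nonneg_of_le (fun p ↦ by positivity) fun ⟨n, l⟩ ↦ ?_
  dsimp only
  have h2 := Real.pow_div_factorial_le_exp (δ / 2 * n) (by positivity) l
  have h3 : (l ! : ℝ) ≤ (ν + l)! := mod_cast Nat.factorial_le (Nat.le_add_left l ν)
  have h4 : (A * n) ^ l / (l ! * (ν + l)!) ≤ (δ / 2 * n) ^ l / l ! * ((A / (δ / 2)) ^ l / l !) := by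
    rw [div_mul_div_comm, ← mul_pow, show δ / 2 * n * (A / (δ / 2)) = A * n by field_simp]
    gcongr
  calc (n : ℝ) ^ ν * Real.exp (-δ * n) * ((A * n) ^ l / (l ! * (ν + l)!))
      ≤ (n : ℝ) ^ ν * Real.exp (-δ * n) *
        (Real.exp (δ / 2 * n) * ((A / (δ / 2)) ^ l / l !)) := by
        gcongr
        exact h4.trans (by gcongr)
    _ = _ := by
        rw [show -(δ / 2) * (n : ℝ) = -δ * n + δ / 2 * n by ring, Real.exp_add]
        ring

theorem summable_mul_exp (ν : ℕ) {A δ : ℝ} (hA : 0 ≤ A) (hδ : 0 < δ) :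
    Summable fun n : ℕ ↦ (n : ℝ) ^ ν * besselClifford ν (-(A * n)) * Real.exp (-δ * n) := by
  refine (summable_pow_mul_exp ν hA hδ).prod.congr fun n ↦ ?_
  dsimp only
  rw [tsum_mul_left, besselClifford]
  simp only [neg_neg]
  ring

end besselClifford

/-! ### A Lipschitz formula with an exponential factor -/

namespace PoincareSeries

/-- The Fourier coefficients of `w ↦ ∑ (w + n) ^ (-(ν + 1)) e(-t / (w + n))`. -/
noncomputable def besselCoeff (ν : ℕ) (t : ℝ) (n : ℕ) : ℂ :=
  (-2 * Real.pi * Complex.I) ^ (ν + 1) * n ^ ν * besselClifford ν (4 * Real.pi ^ 2 * t * n)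

theorem norm_e (z : ℂ) : ‖e z‖ = Real.exp (-(2 * Real.pi * z.im)) := by
  rw [e, Complex.norm_exp]
  congr 1
  simp

theorem e_add (z w : ℂ) : e (z + w) = e z * e w := by
  rw [e, e, e, ← Complex.exp_add]
  ring_nf

theorem e_nat_mul (n : ℕ) (z : ℂ) : e (n * z) = e z ^ n := by
  rw [e, e, ← Complex.exp_nat_mul]
  ring_nf

theorem norm_besselCoeff_mul_e_le (ν : ℕ) {t T : ℝ} (ht : 0 ≤ t) (hT : t ≤ T) (n : ℕ) (z : ℂ) :
    ‖besselCoeff ν t n * e (n * z)‖ ≤ (2 * Real.pi) ^ (ν + 1) *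
      ((n : ℝ) ^ ν * besselClifford ν (-(4 * Real.pi ^ 2 * T * n)) *
        Real.exp (-(2 * Real.pi * z.im) * n)) := by
  have h := besselClifford.norm_le_of_abs_le ν (y := 4 * Real.pi ^ 2 * t * n)
    (Y := 4 * Real.pi ^ 2 * T * n) (by rw [abs_of_nonneg (by positivity)]; gcongr)
  rw [besselCoeff, norm_mul, norm_mul, norm_mul, norm_pow, norm_pow, norm_e]
  have h2 : ‖(-2 * Real.pi * Complex.I : ℂ)‖ = 2 * Real.pi := by
    simp [Real.pi_nonneg]
  have h3 : -(2 * Real.pi * ((n : ℂ) * z).im) = -(2 * Real.pi * z.im) * n := by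
    simp
    ring
  rw [h2, h3, Complex.norm_natCast]
  calc _ = (2 * Real.pi) ^ (ν + 1) * ((n : ℝ) ^ ν *
        ‖(besselClifford ν (4 * Real.pi ^ 2 * t * n) : ℂ)‖ *
        Real.exp (-(2 * Real.pi * z.im) * n)) := by ring
    _ ≤ _ := by gcongr

theorem summable_besselCoeff_bound (ν : ℕ) {T : ℝ} (hT : 0 ≤ T) (z : UpperHalfPlane) :
    Summable fun n : ℕ ↦ (2 * Real.pi) ^ (ν + 1) *
      ((n : ℝ) ^ ν * besselClifford ν (-(4 * Real.pi ^ 2 * T * n)) *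
        Real.exp (-(2 * Real.pi * z.im) * n)) :=
  (besselClifford.summable_mul_exp ν (by positivity)
    (mul_pos Real.two_pi_pos z.im_pos)).mul_left _

/-- Expand the exponential in powers of t/(w+n), apply the Lipschitz formula in weight ν + l + 1 for
each l, and resum. `G` and `H` are the double series before and after; both converge absolutely,
which permits the interchanges. -/
theorem hasSum_besselCoeff (ν : ℕ) (hν : 1 ≤ ν) {t : ℝ} (ht : 0 ≤ t) (w : UpperHalfPlane) :
    HasSum (fun n : ℤ ↦ 1 / ((w : ℂ) + n) ^ (ν + 1) * e (-(t / ((w : ℂ) + n))))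
      (∑' n : ℕ, besselCoeff ν t n * e (n * (w : ℂ))) := by
  have hw := w.im_pos
  have hne (n : ℤ) : (w : ℂ) + n ≠ 0 := fun h ↦ by
    have := congrArg Complex.im h
    simp at this
    exact hw.ne' this
  have him (n : ℤ) : w.im ≤ ‖(w : ℂ) + n‖ := by
    have := Complex.abs_im_le_norm ((w : ℂ) + n)
    simp only [Complex.add_im, UpperHalfPlane.coe_im, Complex.intCast_im, add_zero] at this
    exact (le_abs_self _).trans this
  let G : ℤ × ℕ → ℂ := fun p ↦
    (-2 * Real.pi * Complex.I * t) ^ p.2 / p.2 ! * (1 / ((w : ℂ) + p.1) ^ (ν + p.2 + 1))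
  have hnorm : ‖(-2 * Real.pi * Complex.I * t : ℂ)‖ = 2 * Real.pi * t := by
    simp [Real.pi_nonneg, abs_of_nonneg ht]
  have hlin : Summable fun n : ℤ ↦ ‖1 / ((w : ℂ) + n) ^ (ν + 1)‖ := by
    have := (EisensteinSeries.linear_right_summable (w : ℂ) 1 (k := (ν + 1 : ℕ))
      (by norm_cast; omega)).norm
    refine this.congr fun n ↦ ?_
    rw [one_div, Int.cast_one, one_mul, zpow_natCast]
  have hG : Summable G := by
    refine Summable.of_norm_bounded (hlin.mul_of_nonneg
      (Real.summable_pow_div_factorial (2 * Real.pi * t / w.im)) (fun _ ↦ norm_nonneg _)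
      (fun l ↦ by positivity)) fun ⟨n, l⟩ ↦ ?_
    simp only [G]
    rw [norm_mul, norm_div, norm_pow, hnorm, Complex.norm_natCast, norm_div, norm_div, norm_one,
      norm_pow, norm_pow, show ν + l + 1 = (ν + 1) + l by ring, pow_add, div_pow]
    have h1 := him n
    have h2 : 0 < ‖(w : ℂ) + n‖ := norm_pos_iff.mpr (hne n)
    calc _ = 1 / ‖(w : ℂ) + n‖ ^ (ν + 1) * ((2 * Real.pi * t) ^ l / ‖(w : ℂ) + n‖ ^ l / l !) := by
          field_simp
      _ ≤ _ := by gcongr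
  have hG1 (n : ℤ) : HasSum (fun l ↦ G (n, l))
      (1 / ((w : ℂ) + n) ^ (ν + 1) * e (-(t / ((w : ℂ) + n)))) := by
    have h := (NormedSpace.expSeries_div_hasSum_exp (𝔸 := ℂ)
      (2 * Real.pi * Complex.I * (-(t / ((w : ℂ) + n))))).mul_left (1 / ((w : ℂ) + n) ^ (ν + 1))
    rw [← Complex.exp_eq_exp_ℂ] at h
    refine h.congr_fun fun l ↦ ?_
    simp only [G]
    rw [show ν + l + 1 = (ν + 1) + l by ring, pow_add, show 2 * Real.pi * Complex.I *
      (-(t / ((w : ℂ) + n))) = (-2 * Real.pi * Complex.I * t) / ((w : ℂ) + n) by ring, div_pow]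
    have := hne n
    field_simp
  let H : ℕ × ℕ → ℂ := fun p ↦ (-2 * Real.pi * Complex.I * t) ^ p.2 / p.2 ! *
    ((-2 * Real.pi * Complex.I) ^ (ν + p.2 + 1) / (ν + p.2)! *
      (p.1 ^ (ν + p.2) * e (p.1 * (w : ℂ))))
  have hH : Summable H := by
    refine Summable.of_norm_bounded ((besselClifford.summable_pow_mul_exp ν
      (A := 4 * Real.pi ^ 2 * t) (by positivity) (mul_pos Real.two_pi_pos hw)).mul_left
      ((2 * Real.pi) ^ (ν + 1))) fun ⟨n, l⟩ ↦ ?_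
    simp only [H]
    have h2 : ‖(-2 * Real.pi * Complex.I : ℂ)‖ = 2 * Real.pi := by
      simp [Real.pi_nonneg]
    have h3 : -(2 * Real.pi * ((n : ℂ) * w).im) = -(2 * Real.pi * w.im) * n := by
      simp
      ring
    rw [norm_mul, norm_div, norm_pow, hnorm, Complex.norm_natCast, norm_mul, norm_mul, norm_div,
      norm_pow, norm_pow, h2, norm_e, h3, Complex.norm_natCast, Complex.norm_natCast]
    refine le_of_eq ?_
    rw [show 4 * Real.pi ^ 2 * t * (n : ℝ) = (2 * Real.pi * t) * (2 * Real.pi) * n by ring,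
      mul_pow _ (n : ℝ), mul_pow _ (2 * Real.pi)]
    ring
  have hH1 (n : ℕ) : ∑' l, H (n, l) = besselCoeff ν t n * e (n * (w : ℂ)) := by
    rw [besselCoeff, besselClifford, Complex.ofReal_tsum, ← tsum_mul_left, ← tsum_mul_right]
    refine tsum_congr fun l ↦ ?_
    simp only [H]
    push_cast
    have : (-(4 * (Real.pi : ℂ) ^ 2 * t * n)) ^ l =
        (-2 * Real.pi * Complex.I * t) ^ l * (-2 * Real.pi * Complex.I) ^ l * n ^ l := by
      rw [← mul_pow, ← mul_pow]
      congr 1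
      linear_combination (-4 * (Real.pi : ℂ) ^ 2 * t * n) * Complex.I_sq
    rw [this]
    field_simp
    ring
  have hGH (l : ℕ) : ∑' n : ℤ, G (n, l) = ∑' n : ℕ, H (n, l) := by
    simp only [G, H]
    rw [tsum_mul_left, tsum_mul_left, tsum_mul_left,
      EisensteinSeries.qExpansion_identity (k := ν + l) (by omega) w]
    simp only [e_nat_mul]
    rfl
  have h := hG.hasSum.prod_fiberwise hG1
  convert! h using 1
  simp_rw [← hH1]
  rw [hG.tsum_prod]
  have e1 := Summable.tsum_comm (f := fun (n : ℤ) l ↦ G (n, l)) hG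
  have e2 := Summable.tsum_comm (f := fun (n : ℕ) l ↦ H (n, l)) hH
  rw [← e1, ← e2]
  simp_rw [hGH]

/-! ### From cosets to bottom rows -/

theorem mul_inv_mem_GammaInfty {γ γ' : SL(2, ℤ)} (h0 : γ 1 0 = γ' 1 0) (h1 : γ 1 1 = γ' 1 1) :
    γ' * γ⁻¹ ∈ GammaInfty := by
  have hdet := Matrix.det_fin_two γ.1
  rw [γ.2] at hdet
  have hdet' := Matrix.det_fin_two γ'.1
  rw [γ'.2] at hdet'
  have e00 : (γ' * γ⁻¹) 0 0 = γ' 0 0 * γ 1 1 - γ' 0 1 * γ 1 0 := by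
    simp [Matrix.adjugate_fin_two, Matrix.mul_apply, Fin.sum_univ_two]
    ring
  have e10 : (γ' * γ⁻¹) 1 0 = γ' 1 0 * γ 1 1 - γ' 1 1 * γ 1 0 := by
    simp [Matrix.adjugate_fin_two, Matrix.mul_apply, Fin.sum_univ_two]
    ring
  have e11 : (γ' * γ⁻¹) 1 1 = γ' 1 1 * γ 0 0 - γ' 1 0 * γ 0 1 := by
    simp [Matrix.adjugate_fin_two, Matrix.mul_apply, Fin.sum_univ_two]
    ring
  refine ⟨?_, ?_, ?_⟩
  · rw [e00, h0, h1]
    exact hdet'.symm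
  · rw [e10, h0, h1]
    ring
  · rw [e11, ← h0, ← h1]
    linear_combination -hdet

theorem summand_eq_of_row_eq (k m : ℕ) (z : ℍ) {γ γ' : SL(2, ℤ)} (h0 : γ 1 0 = γ' 1 0)
    (h1 : γ 1 1 = γ' 1 1) : summand k m z γ = summand k m z γ' := by
  simpa using (summand_mul_left k m z _ γ (mul_inv_mem_GammaInfty h0 h1)).symm

theorem summand_neg (k m : ℕ) (hk : Even k) (z : ℍ) (γ : SL(2, ℤ)) :
    summand k m z (-γ) = summand k m z γ := by
  have hj : j (-γ) z = -j γ z := by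
    simp [j]
    ring
  rw [summand, summand, hj, ModularGroup.SL_neg_smul, zpow_neg, zpow_neg, zpow_natCast,
    zpow_natCast, hk.neg_pow]

/-- The bottom row of a matrix representing a coset `Γ_∞ γ`. -/
def bottomRow (N : ℕ) : Cosets N → ℤ × ℤ :=
  Quotient.lift (fun γ : CongruenceSubgroup.Gamma0 N ↦
    ((γ : SL(2, ℤ)) 1 0, (γ : SL(2, ℤ)) 1 1)) (by
    intro a b hab
    have h : b * a⁻¹ ∈ GammaInfty.subgroupOf (CongruenceSubgroup.Gamma0 N) :=
      QuotientGroup.rightRel_apply.mp hab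
    obtain ⟨h1, h2, h3⟩ : (b : SL(2, ℤ)) * (a : SL(2, ℤ))⁻¹ ∈ GammaInfty := by
      simpa [Subgroup.mem_subgroupOf] using h
    have hb : (b : SL(2, ℤ)) = ((b : SL(2, ℤ)) * (a : SL(2, ℤ))⁻¹) * a := by simp
    generalize (b : SL(2, ℤ)) * (a : SL(2, ℤ))⁻¹ = t at *
    simp [hb, Matrix.SpecialLinearGroup.coe_mul, Matrix.mul_apply, Fin.sum_univ_two, h2, h3])

theorem bottomRow_injective (N : ℕ) : Function.Injective (bottomRow N) := by
  intro x y
  induction x using Quotient.inductionOn with | _ a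
  induction y using Quotient.inductionOn with | _ b
  intro h
  obtain ⟨h0, h1⟩ := Prod.ext_iff.mp h
  change (a : SL(2, ℤ)) 1 0 = (b : SL(2, ℤ)) 1 0 at h0
  change (a : SL(2, ℤ)) 1 1 = (b : SL(2, ℤ)) 1 1 at h1
  refine Quotient.sound (QuotientGroup.rightRel_apply.mpr ?_)
  rw [Subgroup.mem_subgroupOf]
  exact mul_inv_mem_GammaInfty h0 h1

theorem exists_row {c d : ℤ} (h : IsCoprime c d) : ∃ γ : SL(2, ℤ), γ 1 0 = c ∧ γ 1 1 = d := by
  obtain ⟨γ, -, hγ⟩ := ModularGroup.bottom_row_surj (R := ℤ) (a := ![c, d]) (by simpa using h)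
  exact ⟨γ, by simpa using congrFun hγ 0, by simpa using congrFun hγ 1⟩

open Classical in
/-- The term of the Poincaré series as a function of the bottom row `(c, d)`, extended by zero to
all pairs of integers. -/
noncomputable def pairTerm (k m N : ℕ) (z : ℍ) (p : ℤ × ℤ) : ℂ :=
  if h : IsCoprime p.1 p.2 ∧ (N : ℤ) ∣ p.1 then summand k m z (exists_row h.1).choose else 0

theorem pairTerm_row (k m N : ℕ) (z : ℍ) {γ : SL(2, ℤ)} (hN : (N : ℤ) ∣ γ 1 0) :
    pairTerm k m N z (γ 1 0, γ 1 1) = summand k m z γ := by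
  have h : IsCoprime (γ 1 0) (γ 1 1) := ModularGroup.bottom_row_coprime γ
  have hs := (exists_row h).choose_spec
  rw [pairTerm, dif_pos ⟨h, hN⟩]
  exact summand_eq_of_row_eq k m z hs.1 hs.2

theorem pairTerm_comp_bottomRow (k m N : ℕ) (z : ℍ) :
    pairTerm k m N z ∘ bottomRow N = cosetTerm k m N z := by
  funext x
  induction x using Quotient.inductionOn with | _ a
  refine pairTerm_row k m N z (γ := a) ?_
  exact (ZMod.intCast_zmod_eq_zero_iff_dvd _ N).mp (CongruenceSubgroup.Gamma0_mem.mp a.2)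

theorem support_pairTerm_subset (k m N : ℕ) (z : ℍ) :
    Function.support (pairTerm k m N z) ⊆ Set.range (bottomRow N) := by
  rintro ⟨c, d⟩ h
  by_cases hcd : IsCoprime c d ∧ (N : ℤ) ∣ c
  · obtain ⟨γ, rfl, rfl⟩ := exists_row hcd.1
    exact ⟨⟦⟨γ, CongruenceSubgroup.Gamma0_mem.mpr
      ((ZMod.intCast_zmod_eq_zero_iff_dvd _ N).mpr hcd.2)⟩⟧, rfl⟩
  · exact absurd (dif_neg hcd) h

theorem norm_summand_le (k m : ℕ) (z : ℍ) (γ : SL(2, ℤ)) :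
    ‖summand k m z γ‖ ≤ ‖j γ z ^ (-(k : ℤ))‖ := by
  rw [summand, norm_mul, norm_e]
  refine mul_le_of_le_one_right (norm_nonneg _) (Real.exp_le_one_iff.mpr ?_)
  have := (γ • z).im_pos
  simp only [Complex.mul_im, Complex.natCast_re, Complex.natCast_im, coe_im, zero_mul, add_zero]
  have := Real.pi_pos
  have : (0 : ℝ) ≤ 2 * Real.pi * (m * (γ • z).im) := by positivity
  linarith

/-- Since |e(mγz)| ≤ 1, the Eisenstein series of weight k is a majorant. -/
theorem summable_pairTerm {k : ℕ} (hk : 3 ≤ k) (m N : ℕ) (z : ℍ) :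
    Summable (pairTerm k m N z) := by
  refine Summable.of_norm_bounded (summable_prod_eisSummand hk z).norm ?_
  rintro ⟨c, d⟩
  by_cases hcd : IsCoprime c d ∧ (N : ℤ) ∣ c
  · obtain ⟨γ, rfl, rfl⟩ := exists_row hcd.1
    rw [pairTerm_row k m N z hcd.2]
    exact norm_summand_le k m z γ
  · rw [pairTerm, dif_neg hcd, norm_zero]
    exact norm_nonneg _

theorem summable_cosetTerm {k : ℕ} (hk : 3 ≤ k) (m N : ℕ) (z : ℍ) :
    Summable (cosetTerm k m N z) := by
  rw [← pairTerm_comp_bottomRow]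
  exact (summable_pairTerm hk m N z).comp_injective (bottomRow_injective N)

theorem poincareSeries_eq_tsum_pairTerm (k m N : ℕ) (z : ℍ) :
    poincareSeries k m N z = ∑' p : ℤ × ℤ, pairTerm k m N z p := by
  rw [poincareSeries, ← pairTerm_comp_bottomRow]
  exact (bottomRow_injective N).tsum_eq (support_pairTerm_subset k m N z)

theorem pairTerm_neg {k : ℕ} (hk : Even k) (m N : ℕ) (z : ℍ) (c d : ℤ) :
    pairTerm k m N z (-c, -d) = pairTerm k m N z (c, d) := by
  by_cases hcd : IsCoprime c d ∧ (N : ℤ) ∣ c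
  · obtain ⟨γ, rfl, rfl⟩ := exists_row hcd.1
    rw [pairTerm_row k m N z hcd.2, ← summand_neg k m hk,
      ← pairTerm_row k m N z (γ := -γ) (by simpa using hcd.2)]
    simp
  · rw [pairTerm, pairTerm, dif_neg hcd, dif_neg]
    simpa [IsCoprime.neg_neg_iff] using hcd

/-- Only d = ±1 is coprime to 0. This is the source of the diagonal term δ_{mn}. -/
theorem tsum_pairTerm_zero {k : ℕ} (hk : Even k) (m N : ℕ) (z : ℍ) :
    ∑' d : ℤ, pairTerm k m N z (0, d) = 2 * e (m * (z : ℂ)) := by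
  have h1 : pairTerm k m N z (0, 1) = e (m * (z : ℂ)) := by
    have := pairTerm_row k m N z (γ := 1) (by simp)
    simpa [summand, j] using this
  have h2 : pairTerm k m N z (0, -1) = e (m * (z : ℂ)) := by
    rw [← h1, ← pairTerm_neg hk, neg_zero, neg_neg]
  rw [tsum_eq_sum (s := {1, -1}), Finset.sum_pair (by norm_num), h1, h2, two_mul]
  intro d hd
  rw [pairTerm, dif_neg]
  rintro ⟨h, -⟩
  rw [isCoprime_zero_left, Int.isUnit_iff] at h
  simp at hd
  tauto

/-! ### Rows with fixed c > 0 and Kloosterman sums -/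

theorem stdAddChar_mul_inv_eq_e {c : ℕ} [NeZero c] (m : ℕ) {a d : ℤ} (h : (c : ℤ) ∣ a * d - 1) :
    ZMod.stdAddChar ((m : ZMod c) * (d : ZMod c)⁻¹) = e (m * (a / c)) := by
  have h1 : (a : ZMod c) * d = 1 := by
    have := (ZMod.intCast_zmod_eq_zero_iff_dvd _ c).mpr h
    push_cast at this
    exact sub_eq_zero.mp this
  have h2 : (d : ZMod c)⁻¹ = a := by
    rw [ZMod.inv_eq_of_mul_eq_one]
    rw [mul_comm, h1]
  rw [h2, show (m : ZMod c) * (a : ZMod c) = ((m * a : ℤ) : ZMod c) by push_cast; rfl,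
    ZMod.stdAddChar_coe, e]
  congr 1
  push_cast
  ring

/-- Uses γz = a/c − 1/(c²(z + d/c)), where a is inverse to d modulo c because the determinant is 1.
-/
theorem pairTerm_of_pos {k m N c : ℕ} [NeZero c] (hN : N ∣ c) (z : ℍ) {d : ℤ}
    (hd : IsCoprime (c : ℤ) d) : pairTerm k m N z (c, d) =
      (1 / (c : ℂ) ^ k * ZMod.stdAddChar ((m : ZMod c) * (d : ZMod c)⁻¹)) *
        (1 / ((z : ℂ) + d / c) ^ k * e (-((m / c ^ 2 : ℝ) / ((z : ℂ) + d / c)))) := by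
  obtain ⟨γ, hc, rfl⟩ := exists_row hd
  have hdet := Matrix.det_fin_two γ.1
  rw [γ.2, hc] at hdet
  have hc0 : (c : ℂ) ≠ 0 := NeZero.ne _
  have hj0 : j γ z ≠ 0 := by
    intro h
    have h3 := congrArg Complex.im h
    simp [j, hc, z.im_ne_zero] at h3
    exact NeZero.ne c h3
  have hj : j γ z = c * ((z : ℂ) + γ 1 1 / c) := by
    rw [j, hc, Int.cast_natCast]
    field_simp
  have hz0 : (z : ℂ) + γ 1 1 / c ≠ 0 := fun h ↦ hj0 (by rw [hj, h, mul_zero])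
  have hdetC : (1 : ℂ) = γ 0 0 * γ 1 1 - γ 0 1 * c := mod_cast hdet
  have hact : ((γ • z : ℍ) : ℂ) = γ 0 0 / c - 1 / (c ^ 2 * ((z : ℂ) + γ 1 1 / c)) := by
    rw [specialLinearGroup_apply]
    simp only [algebraMap_int_eq, eq_intCast, Complex.ofReal_intCast]
    have : ((γ 1 0 : ℤ) : ℂ) * z + (γ 1 1 : ℤ) = j γ z := rfl
    rw [this, hj]
    have hz1 : (z : ℂ) * c + γ 1 1 ≠ 0 := fun h ↦ hj0 (by rw [j, hc, Int.cast_natCast, mul_comm, h])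
    field_simp
    linear_combination hdetC
  have hp := pairTerm_row k m N z (γ := γ) (by rw [hc]; exact mod_cast hN)
  rw [hc] at hp
  rw [hp, summand, stdAddChar_mul_inv_eq_e m (a := γ 0 0) ⟨γ 0 1, by linarith⟩, hact, hj, mul_sub,
    sub_eq_add_neg, e_add, zpow_neg, zpow_natCast, mul_pow]
  have h4 : (m : ℂ) * (1 / (c ^ 2 * ((z : ℂ) + γ 1 1 / c))) =
      (m / c ^ 2 : ℝ) / ((z : ℂ) + γ 1 1 / c) := by
    push_cast
    field_simp
  rw [h4]
  field_simp

/-- The integer `u + c n` with `u` the representative in `[0, c)` of a unit modulo `c`. -/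
def unitLift (c : ℕ) (p : (ZMod c)ˣ × ℤ) : ℤ := (p.1 : ZMod c).val + c * p.2

theorem unitLift_cast {c : ℕ} [NeZero c] (p : (ZMod c)ˣ × ℤ) :
    ((unitLift c p : ℤ) : ZMod c) = p.1 := by
  simp [unitLift]

theorem unitLift_injective (c : ℕ) [NeZero c] : Function.Injective (unitLift c) := by
  intro p q h
  have h1 : p.1 = q.1 := Units.ext (by rw [← unitLift_cast p, ← unitLift_cast q, h])
  refine Prod.ext h1 ?_
  rw [unitLift, unitLift, h1] at h
  exact mul_left_cancel₀ (NeZero.ne (c : ℤ)) (add_left_cancel h)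

theorem isCoprime_iff_isUnit_cast {c : ℕ} {d : ℤ} :
    IsCoprime (c : ℤ) d ↔ IsUnit (d : ZMod c) := by
  rw [ZMod.coe_int_isUnit_iff_isCoprime]

theorem mem_range_unitLift {c : ℕ} [NeZero c] {d : ℤ} (h : IsCoprime (c : ℤ) d) :
    d ∈ Set.range (unitLift c) := by
  obtain ⟨u, hu⟩ := isCoprime_iff_isUnit_cast.mp h
  have h1 : (c : ℤ) ∣ d - (u : ZMod c).val := by
    rw [← ZMod.intCast_zmod_eq_zero_iff_dvd]
    simp [hu]
  obtain ⟨n, hn⟩ := h1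
  exact ⟨(u, n), by rw [unitLift]; linarith⟩

theorem stdAddChar_mul_eq_e {c : ℕ} [NeZero c] (n : ℕ) (x : ZMod c) :
    ZMod.stdAddChar ((n : ZMod c) * x) = e (n * (x.val / c)) := by
  have : (n : ZMod c) * x = ((n * x.val : ℤ) : ZMod c) := by simp
  rw [this, ZMod.stdAddChar_coe, e]
  congr 1
  push_cast
  ring

/-- The contribution of the bottom rows `(c, d)` with a fixed `c > 0` to the `n`-th Fourier
coefficient of the Poincaré series of weight `ν + 1`. -/
noncomputable def levelCoeff (ν m c : ℕ) [NeZero c] (n : ℕ) : ℂ :=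
  1 / (c : ℂ) ^ (ν + 1) * besselCoeff ν (m / c ^ 2) n *
    kloostermanSum (ZMod.stdAddChar (N := c)) m n

/-- The majorant is a function of c times a function of n, as the interchange of the two sums
requires. The trivial bound c for the Kloosterman sum costs one power of c. -/
theorem norm_levelCoeff_mul_e_le (ν m c : ℕ) [NeZero c] (n : ℕ) (z : ℂ) :
    ‖levelCoeff ν m c n * e (n * z)‖ ≤ 1 / (c : ℝ) ^ ν * ((2 * Real.pi) ^ (ν + 1) *
      ((n : ℝ) ^ ν * besselClifford ν (-(4 * Real.pi ^ 2 * m * n)) *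
        Real.exp (-(2 * Real.pi * z.im) * n))) := by
  have hc : (1 : ℝ) ≤ c := mod_cast NeZero.one_le
  have h1 : (m : ℝ) / c ^ 2 ≤ m := div_le_self (by positivity) (one_le_pow₀ hc)
  have h2 := norm_besselCoeff_mul_e_le ν (t := m / c ^ 2) (by positivity) h1 n z
  have h3 : ‖kloostermanSum (ZMod.stdAddChar (N := c)) m n‖ ≤ c := by
    refine (norm_kloostermanSum_le _ _ _).trans ?_
    rw [ZMod.card_units_eq_totient]
    exact mod_cast Nat.totient_le c
  generalize (2 * Real.pi) ^ (ν + 1) * _ = B at h2 ⊢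
  have hB := (norm_nonneg _).trans h2
  calc ‖levelCoeff ν m c n * e (n * z)‖ = 1 / (c : ℝ) ^ (ν + 1) *
        ‖besselCoeff ν (m / c ^ 2) n * e (n * z)‖ *
          ‖kloostermanSum (ZMod.stdAddChar (N := c)) m n‖ := by
        rw [levelCoeff]
        simp only [norm_mul, norm_div, norm_one, norm_pow, Complex.norm_natCast]
        ring
    _ ≤ 1 / (c : ℝ) ^ (ν + 1) * B * c := by gcongr
    _ = _ := by
        rw [pow_succ (c : ℝ)]
        field_simp

/-- Write d = u + cn with u a unit modulo c. The sum over n is `hasSum_besselCoeff` at w = z + u/c,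
and the phases e(nu/c) and e(mu⁻¹/c) assemble into the Kloosterman sum over u. -/
theorem tsum_pairTerm_pos {ν : ℕ} (hν : 2 ≤ ν) {m N c : ℕ} [NeZero c] (hN : N ∣ c) (z : ℍ) :
    ∑' d : ℤ, pairTerm (ν + 1) m N z (c, d) = ∑' n : ℕ, levelCoeff ν m c n * e (n * (z : ℂ)) := by
  have hc0 : (c : ℂ) ≠ 0 := NeZero.ne _
  have hsupp : Function.support (fun d : ℤ ↦ pairTerm (ν + 1) m N z (c, d)) ⊆
      Set.range (unitLift c) := fun d hd ↦ by
    by_contra h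
    exact hd (dif_neg fun h' ↦ h (mem_range_unitLift h'.1))
  have hsum : Summable fun p : (ZMod c)ˣ × ℤ ↦ pairTerm (ν + 1) m N z (c, unitLift c p) :=
    (((summable_pairTerm (k := ν + 1) (by omega) m N z).prod_factor (c : ℤ)).comp_injective
      (unitLift_injective c))
  let w (u : (ZMod c)ˣ) : ℍ := ((u : ZMod c).val / c : ℝ) +ᵥ z
  have hw (u : (ZMod c)ˣ) : (w u : ℂ) = z + (u : ZMod c).val / c := by
    rw [coe_vadd]
    push_cast
    ring
  have hbs (u : (ZMod c)ˣ) :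
      Summable fun n : ℕ ↦ besselCoeff ν (m / c ^ 2) n * e (n * (w u : ℂ)) :=
    .of_norm_bounded (summable_besselCoeff_bound ν (T := m / c ^ 2) (by positivity) (w u))
      fun n ↦ norm_besselCoeff_mul_e_le ν (by positivity) le_rfl n _
  rw [← (unitLift_injective c).tsum_eq hsupp, hsum.tsum_prod, tsum_fintype]
  have key (u : (ZMod c)ˣ) : ∑' n : ℤ, pairTerm (ν + 1) m N z (c, unitLift c (u, n)) =
      ∑' n : ℕ, (1 / (c : ℂ) ^ (ν + 1) *
        ZMod.stdAddChar ((m : ZMod c) * ((u⁻¹ : (ZMod c)ˣ) : ZMod c))) *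
          (besselCoeff ν (m / c ^ 2) n * e (n * (w u : ℂ))) := by
    rw [tsum_mul_left, ← (hasSum_besselCoeff ν (by omega) (t := m / c ^ 2) (by positivity)
      (w u)).tsum_eq, ← tsum_mul_left]
    refine tsum_congr fun n ↦ ?_
    rw [pairTerm_of_pos hN z (isCoprime_iff_isUnit_cast.mpr (by rw [unitLift_cast]; exact u.isUnit)),
      unitLift_cast, ZMod.inv_coe_unit, hw]
    have : (z : ℂ) + unitLift c (u, n) / c = z + (u : ZMod c).val / c + n := by
      rw [unitLift]
      push_cast
      field_simp
      ring
    rw [this]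
  simp_rw [key]
  rw [← Summable.tsum_finsetSum fun u _ ↦ (hbs u).mul_left _]
  refine tsum_congr fun n ↦ ?_
  rw [levelCoeff, kloostermanSum, Finset.mul_sum, Finset.sum_mul]
  refine Finset.sum_congr rfl fun u _ ↦ ?_
  rw [AddChar.map_add_eq_mul, stdAddChar_mul_eq_e n, hw, mul_add, e_add]
  ring

/-! ### The Fourier expansion and its uniqueness -/

/-- The `n`-th Fourier coefficient of the Poincaré series of weight `ν + 1`. -/
noncomputable def coeffFormula (ν m N n : ℕ) : ℂ :=
  2 * ((if n = m then 1 else 0) + ∑' c : ℕ+, if N ∣ c then levelCoeff ν m c n else 0)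

theorem summable_levelCoeff {ν : ℕ} (hν : 2 ≤ ν) (m N : ℕ) (z : ℍ) :
    Summable fun p : ℕ+ × ℕ ↦
      (if N ∣ p.1 then levelCoeff ν m p.1 p.2 else 0) * e (p.2 * (z : ℂ)) := by
  have h1 : Summable fun c : ℕ+ ↦ 1 / (c : ℝ) ^ ν :=
    (Real.summable_one_div_nat_pow.mpr (by omega)).comp_injective PNat.coe_injective
  refine Summable.of_norm_bounded (h1.mul_of_nonneg
    (summable_besselCoeff_bound ν (T := m) (by positivity) z) (fun _ ↦ by positivity) ?_) ?_
  · intro n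
    have := (norm_nonneg _).trans
      (norm_besselCoeff_mul_e_le ν (T := m) (by positivity) le_rfl n z)
    simpa using this
  · rintro ⟨c, n⟩
    refine le_trans ?_ (norm_levelCoeff_mul_e_le ν m c n z)
    dsimp only
    split_ifs
    · rfl
    · rw [zero_mul, norm_zero]
      positivity

/-- The row c = 0 gives the diagonal term; c and −c contribute equally because the weight is even,
whence the overall factor 2. -/
theorem hasSum_coeffFormula {ν : ℕ} (hν : 2 ≤ ν) (hk : Even (ν + 1)) (m N : ℕ) (z : ℍ) :
    HasSum (fun n : ℕ ↦ coeffFormula ν m N n * e (n * (z : ℂ)))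
      (poincareSeries (ν + 1) m N z) := by
  have hs := summable_pairTerm (k := ν + 1) (by omega) m N z
  have hl := summable_levelCoeff hν m N z
  have heven : (fun c : ℤ ↦ ∑' d : ℤ, pairTerm (ν + 1) m N z (c, d)).Even := fun c ↦ by
    dsimp only
    rw [← (Equiv.neg ℤ).tsum_eq]
    exact tsum_congr fun d ↦ pairTerm_neg hk m N z c d
  have hpos (c : ℕ+) : ∑' d : ℤ, pairTerm (ν + 1) m N z ((c : ℕ), d) =
      ∑' n : ℕ, (if N ∣ c then levelCoeff ν m c n else 0) * e (n * (z : ℂ)) := by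
    split_ifs with h
    · exact tsum_pairTerm_pos hν h z
    · simp only [zero_mul, tsum_zero]
      convert tsum_zero with d
      exact dif_neg fun h' ↦ h (Int.natCast_dvd_natCast.mp h'.2)
  have h1 : HasSum (fun n : ℕ ↦ (if n = m then 1 else 0) * e (n * (z : ℂ))) (e (m * (z : ℂ))) := by
    convert hasSum_single (f := fun n : ℕ ↦ (if n = m then 1 else 0) * e (n * (z : ℂ))) m ?_
    · simp
    · intro n hn
      simp [hn]
  have h2 : HasSum (fun n : ℕ ↦ (∑' c : ℕ+, if N ∣ c then levelCoeff ν m c n else 0) *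
      e (n * (z : ℂ))) (∑' c : ℕ+, ∑' n : ℕ,
        (if N ∣ c then levelCoeff ν m c n else 0) * e (n * (z : ℂ))) := by
    have h := hl.prod_symm.hasSum.prod_fiberwise fun n ↦ (hl.prod_symm.prod_factor n).hasSum
    convert! h using 1
    · funext n
      exact tsum_mul_right.symm
    · exact hl.tsum_prod.symm.trans ((Equiv.prodComm ℕ ℕ+).tsum_eq _).symm
  rw [poincareSeries_eq_tsum_pairTerm, hs.tsum_prod,
    tsum_int_eq_zero_add_two_mul_tsum_pnat heven hs.prod, tsum_pairTerm_zero hk]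
  convert! (h1.add h2).mul_left 2 using 1
  · funext n
    rw [coeffFormula]
    ring
  · rw [mul_add, nsmul_eq_mul, Nat.cast_ofNat, ← tsum_congr hpos]

theorem e_eq_qParam (z : ℂ) : e z = Function.Periodic.qParam 1 z := by
  rw [e, Function.Periodic.qParam]
  simp

/-- The Fourier coefficients of a function given by a convergent Fourier expansion. -/
theorem fourierCoeff_eq_of_hasSum {f : ℍ → ℂ} {c : ℕ → ℂ}
    (hf : ∀ z : ℍ, HasSum (fun n : ℕ ↦ c n * e (n * (z : ℂ))) (f z)) (n : ℕ) :
    fourierCoeff f n = c n := by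
  have hval {q : ℂ} (hq : ‖q‖ < 1) (hq0 : q ≠ 0) :
      HasSum (fun n : ℕ ↦ c n * q ^ n) (cuspFunction 1 f q) := by
    have him := Function.Periodic.im_invQParam_pos_of_norm_lt_one one_pos hq hq0
    have h := hf ⟨Function.Periodic.invQParam 1 q, him⟩
    have h2 : cuspFunction 1 f q = f ⟨Function.Periodic.invQParam 1 q, him⟩ := by
      rw [cuspFunction, Function.Periodic.cuspFunction_eq_of_nonzero 1 _ hq0, Function.comp_apply,
        ofComplex_apply_of_im_pos him]
    rw [h2]
    simp only [e_nat_mul] at h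
    simp only [e_eq_qParam, Function.Periodic.qParam_right_inv one_ne_zero hq0] at h
    exact h
  have hps : HasFPowerSeriesOnBall (fun q ↦ ∑' n : ℕ, c n * q ^ n)
      (FormalMultilinearSeries.ofScalars ℂ c) 0 1 := by
    constructor
    · refine le_of_forall_lt_imp_le_of_dense fun r hr ↦ ?_
      rcases eq_or_ne r 0 with rfl | hr'
      · simp
      · lift r to NNReal using hr.ne_top
        apply FormalMultilinearSeries.le_radius_of_summable
        simpa using (hval (q := r) (by simpa using hr) (mod_cast hr')).summable.norm
    · simp
    · intro y hy
      have hy1 : ‖y‖ < 1 := by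
        rwa [← ENNReal.coe_one, Metric.eball_coe, NNReal.coe_one, mem_ball_zero_iff] at hy
      have hs : Summable fun n : ℕ ↦ c n * y ^ n := by
        rcases eq_or_ne y 0 with rfl | hy0
        · exact summable_of_ne_finset_zero (s := {0}) fun n hn ↦ by
            rw [zero_pow (by simpa using hn), mul_zero]
        · exact (hval hy1 hy0).summable
      simpa [mul_comm] using hs.hasSum
  have hne : cuspFunction 1 f =ᶠ[nhdsWithin 0 {0}ᶜ] fun q ↦ ∑' n : ℕ, c n * q ^ n := by
    filter_upwards [self_mem_nhdsWithin, mem_nhdsWithin_of_mem_nhds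
      (Metric.ball_mem_nhds (0 : ℂ) one_pos)] with q hq0 hq
    exact (hval (by simpa using hq) hq0).tsum_eq.symm
  have hat : HasFPowerSeriesAt (cuspFunction 1 f) (FormalMultilinearSeries.ofScalars ℂ c) 0 := by
    -- At q = 0 the cusp function is by definition the limit along q ≠ 0, which is the value of the
    -- power series by continuity.
    refine hps.hasFPowerSeriesAt.congr (eventuallyEq_nhds_of_eventuallyEq_nhdsNE hne.symm ?_)
    rw [cuspFunction, Function.Periodic.cuspFunction_zero_eq_limUnder_nhds_ne]
    exact ((hps.hasFPowerSeriesAt.continuousAt.tendsto.mono_left nhdsWithin_le_nhds).congr'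
      hne.symm).limUnder_eq.symm
  have h2 := hat.analyticAt.hasFPowerSeriesAt
  have h3 := congrArg (FormalMultilinearSeries.coeff · n) (hat.eq_formalMultilinearSeries h2)
  simp only [FormalMultilinearSeries.coeff_ofScalars] at h3
  rw [fourierCoeff, qExpansion_coeff, h3]
  ring

/-! ### Bounds for the first coefficient -/

theorem coeffFormula_zero {ν m : ℕ} (hν : ν ≠ 0) (hm : 1 ≤ m) (N : ℕ) :
    coeffFormula ν m N 0 = 0 := by
  simp [coeffFormula, levelCoeff, besselCoeff, hν, (Nat.one_le_iff_ne_zero.mp hm).symm]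

theorem norm_levelCoeff_one (ν m c : ℕ) [NeZero c] : ‖levelCoeff ν m c 1‖ =
    (2 * Real.pi) ^ (ν + 1) / (c : ℝ) ^ (ν + 1) *
      |besselClifford ν (4 * Real.pi ^ 2 * (m / c ^ 2))| *
        ‖kloostermanSum (ZMod.stdAddChar (N := c)) m 1‖ := by
  have h2 : ‖(-2 * Real.pi * Complex.I : ℂ)‖ = 2 * Real.pi := by
    simp [Real.pi_nonneg]
  rw [levelCoeff, besselCoeff]
  simp only [norm_mul, norm_div, norm_one, norm_pow, Complex.norm_natCast, Nat.cast_one, one_pow,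
    mul_one, h2, Complex.norm_real, Real.norm_eq_abs]
  ring

section Range

variable {ν m N : ℕ}

/-- The only use of the upper bound on m: it keeps the Bessel argument in the non-oscillating range
for every level c ≥ N. -/
theorem bessel_arg_le (hm : (m : ℝ) ≤ (ν : ℝ) ^ 2 * (N : ℝ) ^ 2 / (16 * Real.pi ^ 2)) {c : ℕ}
    [NeZero c] (hc : N ≤ c) : 4 * Real.pi ^ 2 * (m / c ^ 2) ≤ (ν : ℝ) ^ 2 / 4 := by
  have hc0 : (0 : ℝ) < c := mod_cast NeZero.pos c
  have hNc : (N : ℝ) ≤ c := mod_cast hc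
  have hpi := Real.pi_pos
  rw [le_div_iff₀ (by positivity)] at hm
  rw [← mul_div_assoc, div_le_iff₀ (by positivity)]
  have : (ν : ℝ) ^ 2 * (N : ℝ) ^ 2 ≤ (ν : ℝ) ^ 2 * (c : ℝ) ^ 2 := by gcongr
  linarith

theorem norm_levelCoeff_one_le (hm : (m : ℝ) ≤ (ν : ℝ) ^ 2 * (N : ℝ) ^ 2 / (16 * Real.pi ^ 2))
    {c : ℕ} [NeZero c] (hc : N ≤ c) :
    ‖levelCoeff ν m c 1‖ ≤ (2 * Real.pi) ^ (ν + 1) / ν ! * (1 / (c : ℝ) ^ ν) := by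
  have hc0 : (0 : ℝ) < c := mod_cast NeZero.pos c
  have hpi := Real.pi_pos
  have hy : (0 : ℝ) ≤ 4 * Real.pi ^ 2 * (m / c ^ 2) := by positivity
  have hy2 : 4 * Real.pi ^ 2 * (m / c ^ 2) ≤ ((ν : ℝ) + 1) ^ 2 / 4 :=
    (bessel_arg_le hm hc).trans (by gcongr; linarith)
  have h3 : ‖kloostermanSum (ZMod.stdAddChar (N := c)) m 1‖ ≤ c := by
    refine (norm_kloostermanSum_le _ _ _).trans ?_
    rw [ZMod.card_units_eq_totient]
    exact mod_cast Nat.totient_le c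
  rw [norm_levelCoeff_one, abs_of_nonneg (besselClifford.nonneg hy hy2)]
  calc _ ≤ (2 * Real.pi) ^ (ν + 1) / (c : ℝ) ^ (ν + 1) * (1 / ν !) * c := by
        gcongr
        exact besselClifford.le_one_div hy hy2
    _ = _ := by
        rw [pow_succ (c : ℝ)]
        field_simp

theorem le_norm_levelCoeff_one [NeZero N]
    (hm : (m : ℝ) ≤ (ν : ℝ) ^ 2 * (N : ℝ) ^ 2 / (16 * Real.pi ^ 2)) {δ : ℝ}
    (hδ : δ ≤ ‖kloostermanSum (ZMod.stdAddChar (N := N)) m 1‖) (hδ0 : 0 ≤ δ) :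
    (2 * Real.pi) ^ (ν + 1) / ν ! * (Real.exp (-(ν / 2)) / (N : ℝ) ^ (ν + 1) * δ) ≤
      ‖levelCoeff ν m N 1‖ := by
  have hN0 : (0 : ℝ) < N := mod_cast NeZero.pos N
  have hpi := Real.pi_pos
  have hy : (0 : ℝ) ≤ 4 * Real.pi ^ 2 * (m / N ^ 2) := by positivity
  have hy1 := bessel_arg_le hm le_rfl
  have hy2 : 4 * Real.pi ^ 2 * (m / N ^ 2) ≤ ((ν : ℝ) + 1) ^ 2 / 4 :=
    hy1.trans (by gcongr; linarith)
  have h1 := besselClifford.exp_mul_one_div_le hy hy2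
  -- For y ≤ ν²/4 the exponent 2y/(ν+1) is at most ν²/(2(ν+1)) ≤ ν/2.
  have h2 : Real.exp (-(ν / 2)) ≤
      Real.exp (-(2 / ((ν : ℝ) + 1) * (4 * Real.pi ^ 2 * (m / N ^ 2)))) := by
    rw [Real.exp_le_exp, neg_le_neg_iff, div_mul_eq_mul_div, div_le_iff₀ (by positivity)]
    have : (0 : ℝ) ≤ ν := by positivity
    linarith
  have h3 : Real.exp (-(ν / 2)) * (1 / ν !) ≤
      |besselClifford ν (4 * Real.pi ^ 2 * (m / N ^ 2))| :=
    le_trans (by gcongr) (h1.trans (le_abs_self _))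
  rw [norm_levelCoeff_one]
  calc _ = (2 * Real.pi) ^ (ν + 1) / (N : ℝ) ^ (ν + 1) * (Real.exp (-(ν / 2)) * (1 / ν !)) * δ := by
        field_simp
    _ ≤ _ := by gcongr

end Range

/-- The value `ζ(2)`, as a sum over the positive integers. -/
noncomputable def zetaTwo : ℝ := ∑' c : ℕ+, 1 / (c : ℝ) ^ 2

theorem hasSum_zetaTwo : HasSum (fun c : ℕ+ ↦ 1 / (c : ℝ) ^ 2) zetaTwo :=
  Summable.hasSum
    ((Real.summable_one_div_nat_pow.mpr one_lt_two).comp_injective PNat.coe_injective)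

/-- The level c = N outweighs all the others. With ν = μ + 2, the factor c^{-ν} splits into c^{-μ} ≤
(2N)^{-μ} and c^{-2}, which sums to at most ζ(2). Against the loss e^{-ν/2} at c = N this leaves the
ratio (e^{1/2}/2)^μ. -/
theorem tsum_levelCoeff_ne_zero {μ m N : ℕ} [NeZero N]
    (hm : (m : ℝ) ≤ ((μ + 2 : ℕ) : ℝ) ^ 2 * (N : ℝ) ^ 2 / (16 * Real.pi ^ 2)) {δ : ℝ}
    (hδ : δ ≤ ‖kloostermanSum (ZMod.stdAddChar (N := N)) m 1‖) (hδ0 : 0 ≤ δ)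
    (h : zetaTwo * N ^ 3 * Real.exp 1 * (Real.exp (1 / 2) / 2) ^ μ < δ) :
    ∑' c : ℕ+, (if N ∣ c then levelCoeff (μ + 2) m c 1 else 0) ≠ 0 := by
  have hN0 : (0 : ℝ) < N := mod_cast NeZero.pos N
  have hpi := Real.pi_pos
  set F : ℕ+ → ℂ := fun c ↦ if N ∣ c then levelCoeff (μ + 2) m c 1 else 0 with hF
  set C := (2 * Real.pi) ^ (μ + 2 + 1) / (μ + 2)! with hC
  have hC0 : 0 < C := by positivity
  have hFle (c : ℕ+) : ‖F c‖ ≤ C * (1 / (c : ℝ) ^ (μ + 2)) := by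
    simp only [hF]
    split_ifs with hd
    · exact norm_levelCoeff_one_le hm (Nat.le_of_dvd c.pos hd)
    · rw [norm_zero]
      positivity
  have hsum : Summable F := .of_norm_bounded (((Real.summable_one_div_nat_pow.mpr
    (by omega : 1 < μ + 2)).comp_injective PNat.coe_injective).mul_left C) hFle
  clear_value C
  let n : ℕ+ := ⟨N, NeZero.pos N⟩
  have hFn : F n = levelCoeff (μ + 2) m N 1 := if_pos dvd_rfl
  rw [hsum.tsum_eq_add_tsum_ite n, hFn]
  intro h0
  have hrest : ‖∑' c, if c = n then 0 else F c‖ ≤ C / (2 * N) ^ μ * zetaTwo := by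
    refine tsum_of_norm_bounded (hasSum_zetaTwo.mul_left _) fun c ↦ ?_
    have hcpos : (0 : ℝ) < c := mod_cast c.pos
    split_ifs with hc
    · rw [norm_zero]
      positivity
    · by_cases hd : N ∣ c
      · refine (hFle c).trans ?_
        have h2N : 2 * N ≤ c := by
          obtain ⟨r, hr⟩ := hd
          have hr0 : r ≠ 0 := by
            rintro rfl
            exact c.ne_zero (by simp at hr)
          have hr1 : r ≠ 1 := by
            rintro rfl
            exact hc (PNat.eq (by simpa [n] using hr))
          have : 2 ≤ r := by omega
          rw [hr]
          nlinarith
        have h2N' : (2 * N : ℝ) ≤ c := mod_cast h2N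
        calc C * (1 / (c : ℝ) ^ (μ + 2)) = C / (c : ℝ) ^ μ * (1 / (c : ℝ) ^ 2) := by
              rw [pow_add]
              field_simp
          _ ≤ _ := by gcongr
      · have : F c = 0 := if_neg hd
        rw [this, norm_zero]
        positivity
  have hmain := le_norm_levelCoeff_one hm hδ hδ0
  rw [eq_neg_of_add_eq_zero_left h0, norm_neg] at hmain
  have h1 := hmain.trans hrest
  rw [← hC, div_mul_eq_mul_div C, mul_div_assoc C] at h1
  have h2 := le_of_mul_le_mul_left h1 hC0
  refine h.not_ge ?_
  have h3 : Real.exp (-((μ + 2 : ℕ) / 2)) = (Real.exp 1)⁻¹ * (Real.exp (1 / 2) ^ μ)⁻¹ := by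
    rw [← Real.exp_nat_mul, ← Real.exp_neg, ← Real.exp_neg, ← Real.exp_add]
    congr 1
    push_cast
    ring
  rw [h3, div_mul_eq_mul_div, div_le_div_iff₀ (by positivity) (by positivity)] at h2
  have h4 := Real.exp_pos 1
  have h5 := Real.exp_pos (1 / 2)
  rw [div_pow, mul_div_assoc', le_div_iff₀ (by positivity)]
  -- Both sides carry the common positive factor N^μ e^{-1} e^{-μ/2}, which is cancelled at the end.
  have h6 : (Real.exp 1)⁻¹ * (Real.exp (1 / 2) ^ μ)⁻¹ * δ * (2 * N) ^ μ =
    (δ * 2 ^ μ) * (N ^ μ * ((Real.exp 1)⁻¹ * (Real.exp (1 / 2) ^ μ)⁻¹)) := by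
    rw [mul_pow]
    ring
  have h7 : zetaTwo * (N : ℝ) ^ (μ + 2 + 1) =
    (zetaTwo * N ^ 3 * Real.exp 1 * Real.exp (1 / 2) ^ μ) *
      (N ^ μ * ((Real.exp 1)⁻¹ * (Real.exp (1 / 2) ^ μ)⁻¹)) := by
    rw [add_assoc, pow_add]
    field_simp
  rw [h6, h7] at h2
  exact le_of_mul_le_mul_right h2 (by positivity)

/-- Serves the case m = 1, where the sum over c only has to stay below the diagonal term 1. -/
theorem norm_tsum_levelCoeff_lt_one {μ m N : ℕ}
    (hm : (m : ℝ) ≤ ((μ + 2 : ℕ) : ℝ) ^ 2 * (N : ℝ) ^ 2 / (16 * Real.pi ^ 2))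
    (h : (2 * Real.pi) ^ (μ + 2 + 1) / (μ + 2)! * zetaTwo < 1) :
    ‖∑' c : ℕ+, (if N ∣ c then levelCoeff (μ + 2) m c 1 else 0)‖ < 1 := by
  refine (tsum_of_norm_bounded (hasSum_zetaTwo.mul_left _) fun c ↦ ?_).trans_lt h
  have hc : (1 : ℝ) ≤ c := mod_cast c.pos
  have hpi := Real.pi_pos
  split_ifs with hd
  · refine (norm_levelCoeff_one_le hm (Nat.le_of_dvd c.pos hd)).trans ?_
    gcongr
    omega
  · rw [norm_zero]
    positivity

theorem coeffFormula_one_ne_zero {μ m N : ℕ} [NeZero N]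
    (hm : (m : ℝ) ≤ ((μ + 2 : ℕ) : ℝ) ^ 2 * (N : ℝ) ^ 2 / (16 * Real.pi ^ 2)) {δ : ℝ}
    (hδ : δ ≤ ‖kloostermanSum (ZMod.stdAddChar (N := N)) m 1‖) (hδ0 : 0 ≤ δ)
    (h : zetaTwo * N ^ 3 * Real.exp 1 * (Real.exp (1 / 2) / 2) ^ μ < δ)
    (h' : (2 * Real.pi) ^ (μ + 2 + 1) / (μ + 2)! * zetaTwo < 1) :
    coeffFormula (μ + 2) m N 1 ≠ 0 := by
  refine mul_ne_zero two_ne_zero ?_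
  by_cases hm1 : 1 = m
  · rw [if_pos hm1]
    intro h0
    have h1 := norm_tsum_levelCoeff_lt_one hm h'
    rw [eq_neg_of_add_eq_zero_right h0, norm_neg, norm_one] at h1
    exact lt_irrefl _ h1
  · rw [if_neg hm1, zero_add]
    exact tsum_levelCoeff_ne_zero hm hδ hδ0 h

theorem eventually_lt {δ : ℝ} (hδ : 0 < δ) (N : ℕ) : ∀ᶠ μ : ℕ in Filter.atTop,
    zetaTwo * N ^ 3 * Real.exp 1 * (Real.exp (1 / 2) / 2) ^ μ < δ ∧
      (2 * Real.pi) ^ (μ + 2 + 1) / (μ + 2)! * zetaTwo < 1 := by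
  -- Amounts to e < 4.
  have h1 : Real.exp (1 / 2) / 2 < 1 := by
    have h2 : Real.exp (1 / 2) ^ 2 = Real.exp 1 := by
      rw [← Real.exp_nat_mul]
      norm_num
    have h3 := Real.exp_one_lt_three
    rw [div_lt_one two_pos]
    nlinarith [Real.exp_pos (1 / 2)]
  have t1 := (tendsto_pow_atTop_nhds_zero_of_lt_one (by positivity) h1).const_mul
    (zetaTwo * N ^ 3 * Real.exp 1)
  have t2 := ((FloorSemiring.tendsto_pow_div_factorial_atTop (2 * Real.pi)).comp
    (Filter.tendsto_add_atTop_nat 2)).const_mul (2 * Real.pi * zetaTwo)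
  rw [mul_zero] at t1 t2
  filter_upwards [t1.eventually_lt_const hδ, t2.eventually_lt_const one_pos] with μ a b
  refine ⟨a, lt_of_eq_of_lt ?_ b⟩
  simp only [Function.comp_apply]
  ring

end PoincareSeries

end

theorem mainTheorem1 (N : ℕ) (hN : Squarefree N) :
    ∃ k₀ : ℕ, ∀ k : ℕ, k₀ ≤ k → Even k → ∀ m : ℕ, 1 ≤ m →
      (m : ℝ) ≤ ((k : ℝ) - 1) ^ 2 * (N : ℝ) ^ 2 / (16 * Real.pi ^ 2) →
      -- the series converges absolutely and is the sum of its Fourier expansion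
      (∀ z : UpperHalfPlane, Summable (PoincareSeries.cosetTerm k m N z)) ∧
      (∀ z : UpperHalfPlane,
        HasSum (fun n : ℕ => PoincareSeries.fourierCoeff (PoincareSeries.poincareSeries k m N) n *
          PoincareSeries.e (n * (z : ℂ))) (PoincareSeries.poincareSeries k m N z)) ∧
      PoincareSeries.fourierCoeff (PoincareSeries.poincareSeries k m N) 1 ≠ 0 ∧
      PoincareSeries.vInfty (PoincareSeries.poincareSeries k m N) = 1 ∧
      ∃ z : UpperHalfPlane, PoincareSeries.poincareSeries k m N z ≠ 0 := by
  have : NeZero N := ⟨hN.ne_zero⟩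
  -- The bound δ holds for all residues of m modulo N, so the threshold for k depends on N alone.
  obtain ⟨δ, hδ0, hδ⟩ := exists_le_norm_kloostermanSum hN (ZMod.stdAddChar (N := N)) 1
  obtain ⟨μ₀, hμ₀⟩ := Filter.eventually_atTop.mp (PoincareSeries.eventually_lt hδ0 N)
  refine ⟨μ₀ + 3, fun k hk heven m hm1 hm ↦ ?_⟩
  obtain ⟨μ, rfl⟩ : ∃ μ, k = μ + 2 + 1 := ⟨k - 3, by omega⟩
  obtain ⟨h1, h2⟩ := hμ₀ μ (by omega)
  have hm' : (m : ℝ) ≤ ((μ + 2 : ℕ) : ℝ) ^ 2 * (N : ℝ) ^ 2 / (16 * Real.pi ^ 2) := by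
    rwa [Nat.cast_add_one, add_sub_cancel_right] at hm
  have hsum := PoincareSeries.hasSum_coeffFormula (ν := μ + 2) (by omega) heven m N
  have hcoeff := PoincareSeries.fourierCoeff_eq_of_hasSum hsum
  have hone := PoincareSeries.coeffFormula_one_ne_zero hm' (hδ m) hδ0.le h1 h2
  refine ⟨fun z ↦ PoincareSeries.summable_cosetTerm (by omega) m N z, fun z ↦ ?_, ?_, ?_, ?_⟩
  · simpa only [hcoeff] using hsum z
  · rwa [hcoeff]
  · refine (PowerSeries.order_eq_nat (n := 1)).mpr ⟨?_, fun i hi ↦ ?_⟩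
    · rw [← hcoeff] at hone
      exact hone
    · obtain rfl : i = 0 := by omega
      exact (hcoeff 0).trans (PoincareSeries.coeffFormula_zero (by omega) hm1 N)
  · by_contra! h0
    -- If the function were identically zero, the zero sequence would also be a Fourier expansion,
    -- and uniqueness would give p(1) = 0.
    have hz := PoincareSeries.fourierCoeff_eq_of_hasSum (c := 0)
      (f := PoincareSeries.poincareSeries (μ + 2 + 1) m N) (fun z ↦ by simp [h0 z]) 1
    rw [hcoeff] at hz
    exact hone hz
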